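/- Let $X$ be a metric space and $f\colon X\to X$ a homeomorphism. For $x\in X$ and $\delta>0$ put $\mathcal P(x)=\{y\in X:\inf_{n\in\mathbb Z}d(f^n(x),f^n(y))=0\}$ and $\Gamma_\delta(x)=\{y\in X: d(f^n(x),f^n(y))\le\delta\ \text{for all } n\in\mathbb Z\}$. The map $f$ is *distal* if $\mathcal P(x)=\{x\}$ for all $x$, *inner-distal* if $\operatorname{Int}\mathcal P(x)=\emptyset$ for all $x$, and *transitive* if some orbit $\{f^n(x):n\in\mathbb Z\}$ is dense. A Borel probability measure $\mu$ on $X$ is *inner-distal* for $f$ if $\mu(\operatorname{Int}\mathcal P(x))=0$ for all $x$; it is *meagre-expansive* for $f$ if there is $\delta>0$ with $\mu(\operatorname{Int}\Gamma_\delta(x))=0$ for all $x$; it has *full support* if its support is $X$. A point $p$ is periodic if $f^n(p)=p$ for some $n\ge 1$. Let $\mathbb S^1=\mathbb R/\mathbb Z$. The rotation number of a homeomorphism $f$ of $\mathbb S^1$ (preserving or reversing orientation) is $\lim_{n\to\infty}(F^n(t)-t)/n$, for any $t\in\mathbb R$ and any lift $F\colon\mathbb R\to\mathbb R$ of $f$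 (a homeomorphism with $f(t+\mathbb Z)=F(t)+\mathbb Z$ for all $t$); it is well defined up to an integer. A *Denjoy map* is a homeomorphism of $\mathbb S^1$ with irrational rotation number that is not transitive. 1. If a homeomorphism of $\mathbb S^1$ has rational rotation number, then the support of each of its inner-distal measures is contained in the set of its periodic points. If, in addition, the set of periodic points is finite, then each of its inner-distal measures is meagre-expansive. 2. A homeomorphism of $\mathbb S^1$ with irrational rotation number is either distal or topologically conjugate to a Denjoy map (and not both); in the latter case each of its inner-distal measures is meagre-expansive. 3. A homeomorphism of $\mathbb S^1$ has an inner-distal measure with full support if and only if it is distal. Moreover, a homeomorphism of $\mathbb S^1$ is inner-distal if and only if it is distal. 4. A homeomorphism of $[0,1]$ has an inner-distal measure with full support if and only if it is the identity or is topologically conjugate to $x\mapsto 1-x$. -/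

import Mathlib

open MeasureTheory Filter Topology unitInterval

namespace InnerDistal

section General

variable {X : Type*} [MetricSpace X]

/-- The proximal cell `P_f(x)` of `x`: the points `y` with `inf_{n ∈ ℤ} d(fⁿ x, fⁿ y) = 0`. -/
def proximalCell (f : X ≃ₜ X) (x : X) : Set X :=
  {y | ⨅ n : ℤ, dist ((f ^ n) x) ((f ^ n) y) = 0}

/-- The dynamic ball `Γ_δ(x)`: the points `y` with `d(fⁿ x, fⁿ y) ≤ δ` for all `n ∈ ℤ`. -/
def dynamicBall (f : X ≃ₜ X) (δ : ℝ) (x : X) : Set X :=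
  {y | ∀ n : ℤ, dist ((f ^ n) x) ((f ^ n) y) ≤ δ}

/-- `f` is distal: `inf_{n ∈ ℤ} d(fⁿ x, fⁿ y) = 0` forces `x = y`. -/
def IsDistal (f : X ≃ₜ X) : Prop :=
  ∀ x y : X, ⨅ n : ℤ, dist ((f ^ n) x) ((f ^ n) y) = 0 → x = y

/-- `f` is inner-distal: every proximal cell has empty interior. -/
def IsInnerDistal (f : X ≃ₜ X) : Prop :=
  ∀ x : X, interior (proximalCell f x) = ∅

/-- `μ` is inner-distal with respect to `f`: the interior of every proximal cell is `μ`-null.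
(Used for Borel probability measures.) -/
def IsInnerDistalMeasure [MeasurableSpace X] (f : X ≃ₜ X) (μ : Measure X) : Prop :=
  ∀ x : X, μ (interior (proximalCell f x)) = 0

/-- `μ` is meagre-expansive with respect to `f`: for some `δ > 0` the interior of every
dynamic ball of radius `δ` is `μ`-null. (Used for Borel probability measures.) -/
def IsMeagreExpansiveMeasure [MeasurableSpace X] (f : X ≃ₜ X) (μ : Measure X) : Prop :=
  ∃ δ : ℝ, 0 < δ ∧ ∀ x : X, μ (interior (dynamicBall f δ x)) = 0

/-- `f` is transitive: some (two-sided) orbit is dense. -/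
def IsTransitive (f : X ≃ₜ X) : Prop :=
  ∃ x : X, closure (Set.range fun n : ℤ => (f ^ n) x) = Set.univ

/-- `f` and `g` are topologically conjugate. -/
def IsConjugate (f g : X ≃ₜ X) : Prop :=
  ∃ h : X ≃ₜ X, ∀ x, h (f x) = g (h x)

end General

/-- `F` is a lift of the homeomorphism `f` of the circle `ℝ / ℤ`. -/
def IsLift (f : UnitAddCircle ≃ₜ UnitAddCircle) (F : ℝ ≃ₜ ℝ) : Prop :=
  ∀ t : ℝ, f (t : UnitAddCircle) = ((F t : ℝ) : UnitAddCircle)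

/-- `ρ` is a rotation number of `f`, computed with some lift. Another lift changes `ρ` by an
integer, so that rationality of `ρ` depends on `f` only. -/
def HasRotationNumber (f : UnitAddCircle ≃ₜ UnitAddCircle) (ρ : ℝ) : Prop :=
  ∃ F : ℝ ≃ₜ ℝ, IsLift f F ∧
    ∀ t : ℝ, Tendsto (fun n : ℕ => (F^[n] t - t) / n) atTop (𝓝 ρ)

def HasRationalRotationNumber (f : UnitAddCircle ≃ₜ UnitAddCircle) : Prop :=
  ∃ r : ℚ, HasRotationNumber f r

def HasIrrationalRotationNumber (f : UnitAddCircle ≃ₜ UnitAddCircle) : Prop :=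
  ∃ ρ : ℝ, Irrational ρ ∧ HasRotationNumber f ρ

/-- A Denjoy map: a circle homeomorphism that is not transitive but has irrational rotation
number. -/
def IsDenjoy (f : UnitAddCircle ≃ₜ UnitAddCircle) : Prop :=
  HasIrrationalRotationNumber f ∧ ¬ IsTransitive f

end InnerDistal

/-! A circle homeomorphism falls into one of two cases. Either some `f ^ m` has an increasing lift
`G` with a fixed point (rational or orientation-reversing case), or `f` has an increasing lift of
irrational translation number.

In the first case, if `G t ≠ t`, the orbit of `t` is monotone and bounded by fixed points, so its
consecutive gaps shrink to zero; nearby points are trapped between iterates of `t`, and the proximal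
cell is a neighbourhood of `t` (`HasFixedLift.mem_nhds_of_ne`). Inner-distal measures thus live on
periodic points, and inner-distality forces `f ^ m = 1`. With finitely many periodic points every
cell is a neighbourhood of its centre, so no inner-distal probability measure exists.

In the second case a continuous monotone `h` semiconjugates the lift to a translation. Points of one
fibre of `h` are proximal, whence distal, transitive and "`h` injective" coincide. If `h` has a
plateau, small dynamic balls lie in proximal cells (`exists_dynamicBall_subset`), which gives
meagre-expansivity.

Full-support inner-distal measures exist exactly when `f` is inner-distal, since volume has full
support. On the interval the trapping argument applies to `f` or `f ^ 2`. -/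

namespace InnerDistal

/-! ### Proximal cells, distality and conjugacy -/

section Proximal

variable {X : Type*} [MetricSpace X]

theorem mem_proximalCell_iff {f : X ≃ₜ X} {x y : X} :
    y ∈ proximalCell f x ↔ ∀ ε > 0, ∃ n : ℤ, dist ((f ^ n) x) ((f ^ n) y) < ε := by
  have hb : BddBelow (Set.range fun n : ℤ => dist ((f ^ n) x) ((f ^ n) y)) :=
    ⟨0, by rintro _ ⟨n, rfl⟩; exact dist_nonneg⟩
  constructor
  · intro h ε hε
    exact exists_lt_of_ciInf_lt (lt_of_eq_of_lt h hε)
  · intro h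
    refine le_antisymm (le_of_forall_pos_le_add fun ε hε => ?_) (le_ciInf fun n => dist_nonneg)
    obtain ⟨n, hn⟩ := h ε hε
    rw [zero_add]
    exact (ciInf_le hb n).trans hn.le

theorem isDistal_iff {f : X ≃ₜ X} :
    IsDistal f ↔ ∀ x y : X, y ∈ proximalCell f x → x = y := Iff.rfl

theorem mem_proximalCell_of_tendsto {f : X ≃ₜ X} {x y : X} (k : ℕ → ℤ)
    (h : Tendsto (fun n => dist ((f ^ k n) x) ((f ^ k n) y)) atTop (𝓝 0)) :
    y ∈ proximalCell f x := by
  refine mem_proximalCell_iff.2 fun ε hε => ?_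
  obtain ⟨n, hn⟩ := (h.eventually (gt_mem_nhds hε)).exists
  exact ⟨k n, hn⟩

theorem proximalCell_pow_subset (f : X ≃ₜ X) (m : ℕ) (x : X) :
    proximalCell (f ^ m) x ⊆ proximalCell f x := by
  intro y hy
  rw [mem_proximalCell_iff] at hy ⊢
  intro ε hε
  obtain ⟨n, hn⟩ := hy ε hε
  exact ⟨m * n, by rwa [zpow_mul, zpow_natCast]⟩

/-- Only finitely many distances occur along the orbit of a pair, so their infimum is a minimum,
positive for distinct points. -/
theorem IsDistal.of_pow_eq_one {f : X ≃ₜ X} {m : ℕ} (hm : 0 < m) (h : f ^ m = 1) :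
    IsDistal f := by
  refine isDistal_iff.2 fun x y hxy => ?_
  by_contra hne
  have hpos : ∀ i : ℕ, 0 < dist ((f ^ i) x) ((f ^ i) y) := fun i =>
    dist_pos.2 fun e => hne ((f ^ i).injective e)
  obtain ⟨i, -, hi⟩ := (Finset.range m).exists_min_image
    (fun i => dist ((f ^ i) x) ((f ^ i) y)) ⟨0, Finset.mem_range.2 hm⟩
  obtain ⟨n, hn⟩ := mem_proximalCell_iff.1 hxy _ (hpos i)
  have hm' : (0 : ℤ) < m := by exact_mod_cast hm
  have h1 := Int.emod_nonneg n hm'.ne'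
  have h2 := Int.emod_lt_of_pos n hm'
  have h3 : f ^ n = f ^ (n % m).toNat := by
    rw [← zpow_natCast, Int.toNat_of_nonneg h1]
    conv_lhs => rw [← Int.emod_add_mul_ediv n m]
    rw [zpow_add, zpow_mul, zpow_natCast f m, h, one_zpow, mul_one]
  rw [h3] at hn
  exact absurd hn (not_lt.2 (hi _ (Finset.mem_range.2 (by omega))))

theorem IsDistal.isInnerDistal [∀ x : X, (𝓝[≠] x).NeBot] {f : X ≃ₜ X} (h : IsDistal f) :
    IsInnerDistal f := by
  intro x
  refine Set.eq_empty_of_subset_empty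
    ((interior_mono fun y hy => ?_).trans (interior_singleton x).subset)
  exact (h x y hy).symm

/-- A measure of full support charges every nonempty open set; conversely `ν` itself serves as the
measure. This removes measures from the full-support claims. -/
theorem exists_isInnerDistalMeasure_iff [MeasurableSpace X] (ν : Measure X)
    [IsProbabilityMeasure ν] [ν.IsOpenPosMeasure] {f : X ≃ₜ X} :
    (∃ μ : Measure X, IsProbabilityMeasure μ ∧ IsInnerDistalMeasure f μ ∧ μ.support = Set.univ) ↔
      IsInnerDistal f := by
  constructor
  · rintro ⟨μ, -, h, hs⟩ x
    by_contra hne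
    obtain ⟨y, hy⟩ := Set.nonempty_iff_ne_empty.2 hne
    have hy' : y ∈ μ.support := hs ▸ Set.mem_univ y
    exact ((Measure.mem_support_iff_forall y).1 hy' _ (isOpen_interior.mem_nhds hy)).ne' (h x)
  · exact fun h => ⟨ν, inferInstance, fun x => by rw [h x, measure_empty], Measure.support_eq_univ⟩

theorem IsConjugate.refl (f : X ≃ₜ X) : IsConjugate f f := ⟨Homeomorph.refl X, fun _ => rfl⟩

theorem conj_pow {f g h : X ≃ₜ X} (hh : ∀ x, h (f x) = g (h x)) (n : ℤ) (x : X) :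
    h ((f ^ n) x) = (g ^ n) (h x) := by
  have h1 : SemiconjBy h f g := by ext x; exact hh x
  exact DFunLike.congr_fun (h1.zpow_right n) x

theorem IsConjugate.isTransitive {f g : X ≃ₜ X} (hfg : IsConjugate f g) (hf : IsTransitive f) :
    IsTransitive g := by
  obtain ⟨h, hh⟩ := hfg
  obtain ⟨x, hx⟩ := hf
  refine ⟨h x, ?_⟩
  have : Set.range (fun n : ℤ => (g ^ n) (h x)) = h '' Set.range fun n : ℤ => (f ^ n) x := by
    rw [← Set.range_comp]
    exact congrArg _ (funext fun n => (conj_pow hh n x).symm)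
  rw [this, ← h.image_closure, hx, Set.image_univ, h.surjective.range_eq]

end Proximal

theorem tendsto_abs_sub_of_abs_sub_le {a b : ℕ → ℝ} {l : ℝ} (ha : Tendsto a atTop (𝓝 l))
    (h : ∀ n, |b n - a (n + 1)| ≤ |a (n + 2) - a n|) :
    Tendsto (fun n => |b n - a (n + 1)|) atTop (𝓝 0) := by
  have h1 : Tendsto (fun n => |a (n + 2) - a n|) atTop (𝓝 0) := by
    have := ((ha.comp (tendsto_add_atTop_nat 2)).sub ha).abs
    simpa using this
  exact squeeze_zero (fun n => abs_nonneg _) h h1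

/-! ### Lifts of circle homeomorphisms and the rational/irrational dichotomy -/

section Lift

variable {f g : UnitAddCircle ≃ₜ UnitAddCircle} {F G : ℝ ≃ₜ ℝ}

theorem coe_eq_coe_iff {x y : ℝ} : (x : UnitAddCircle) = y ↔ ∃ n : ℤ, x = y + n := by
  rw [← sub_eq_zero, ← AddCircle.coe_sub, AddCircle.coe_eq_zero_iff]
  refine exists_congr fun n => ?_
  rw [zsmul_eq_mul, mul_one, eq_comm, sub_eq_iff_eq_add']

theorem exists_dist_eq (x y : ℝ) : ∃ n : ℤ, dist (x : UnitAddCircle) y = |x - (y + n)| :=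
  ⟨round (x - y), by rw [dist_eq_norm, ← AddCircle.coe_sub, UnitAddCircle.norm_eq, sub_sub]⟩

theorem dist_coe_le (x y : ℝ) : dist (x : UnitAddCircle) y ≤ |x - y| := by
  rw [dist_eq_norm, ← AddCircle.coe_sub, UnitAddCircle.norm_eq]
  simpa using round_le (x - y) 0

theorem IsLift.mul (hf : IsLift f F) (hg : IsLift g G) : IsLift (f * g) (F * G) := fun t => by
  rw [Homeomorph.mul_apply, Homeomorph.mul_apply, hg, hf]

theorem IsLift.inv (hf : IsLift f F) : IsLift f⁻¹ F⁻¹ := fun t => by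
  rw [Homeomorph.inv_apply, Homeomorph.inv_apply, Homeomorph.symm_apply_eq, hf,
    Homeomorph.apply_symm_apply]

theorem IsLift.pow (hf : IsLift f F) (n : ℕ) : IsLift (f ^ n) (F ^ n) := by
  induction n with
  | zero => intro t; simp
  | succ n ih => rw [pow_succ, pow_succ]; exact ih.mul hf

theorem IsLift.zpow (hf : IsLift f F) : ∀ n : ℤ, IsLift (f ^ n) (F ^ n)
  | .ofNat n => by simpa using hf.pow n
  | .negSucc n => by simpa only [zpow_negSucc] using (hf.pow (n + 1)).inv

theorem eq_of_continuous_of_forall_int {c : ℝ → ℝ} (hc : Continuous c)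
    (h : ∀ t, ∃ n : ℤ, c t = n) (s t : ℝ) : c s = c t := by
  choose n hn using h
  have hn' : c = (fun m : ℤ => (m : ℝ)) ∘ n := funext hn
  have : Continuous n := Int.isClosedEmbedding_coe_real.isEmbedding.continuous_iff.2 (hn' ▸ hc)
  rw [hn, hn, PreconnectedSpace.constant inferInstance this]

theorem exists_continuous_lift (f : UnitAddCircle ≃ₜ UnitAddCircle) :
    ∃ F : C(ℝ, ℝ), ∀ t : ℝ, ((F t : ℝ) : UnitAddCircle) = f t := by
  obtain ⟨e, he⟩ := QuotientAddGroup.mk_surjective (f ((0 : ℝ) : UnitAddCircle))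
  obtain ⟨F, ⟨-, hF⟩, -⟩ := (AddCircle.isCoveringMap_coe (1 : ℝ)).existsUnique_continuousMap_lifts
    (⟨fun t : ℝ => f (t : UnitAddCircle), f.continuous.comp (AddCircle.continuous_mk' 1)⟩ :
      C(ℝ, UnitAddCircle)) 0 e he
  exact ⟨F, fun t => congrFun hF t⟩

/-- Lifts of `f` and of its inverse compose, in either order, to a translation by an integer;
correcting one of them by this constant makes them mutually inverse. -/
theorem exists_isLift (f : UnitAddCircle ≃ₜ UnitAddCircle) : ∃ F : ℝ ≃ₜ ℝ, IsLift f F := by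
  obtain ⟨F, hF⟩ := exists_continuous_lift f
  obtain ⟨G, hG⟩ := exists_continuous_lift f.symm
  have h1 : ∀ t, ∃ n : ℤ, G (F t) - t = n := fun t => by
    obtain ⟨n, hn⟩ := coe_eq_coe_iff.1
      (show ((G (F t) : ℝ) : UnitAddCircle) = t by rw [hG, hF, Homeomorph.symm_apply_apply])
    exact ⟨n, by rw [hn]; ring⟩
  have h2 : ∀ t, ∃ n : ℤ, F (G t) - t = n := fun t => by
    obtain ⟨n, hn⟩ := coe_eq_coe_iff.1
      (show ((F (G t) : ℝ) : UnitAddCircle) = t by rw [hF, hG, Homeomorph.apply_symm_apply])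
    exact ⟨n, by rw [hn]; ring⟩
  have c1 := eq_of_continuous_of_forall_int (by fun_prop) h1
  have c2 := eq_of_continuous_of_forall_int (by fun_prop) h2
  set k := G (F 0) - 0 with hk
  have e1 : ∀ t, G (F t) - k = t := fun t => by rw [hk, c1 0 t]; ring
  have hsurj : ∀ t, ∃ s, F s = t := fun t => by
    have := c2 0 (t - (F (G 0) - 0))
    exact ⟨_, by linarith⟩
  refine ⟨⟨⟨F, fun t => G t - k, e1, fun t => ?_⟩, F.continuous, by
    show Continuous fun t => G t - k; fun_prop⟩, fun t => (hF t).symm⟩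
  obtain ⟨s, rfl⟩ := hsurj t
  exact congrArg F (e1 s)

/-- A lift of an orientation preserving circle homeomorphism. -/
structure IsDegOne (F : ℝ ≃ₜ ℝ) : Prop where
  strictMono : StrictMono F
  map_add_one : ∀ t, F (t + 1) = F t + 1

theorem IsLift.exists_add_one (hf : IsLift f F) : ∃ k : ℤ, ∀ t, F (t + 1) = F t + k := by
  have h : ∀ t, ∃ n : ℤ, F (t + 1) - F t = n := fun t => by
    obtain ⟨n, hn⟩ := coe_eq_coe_iff.1
      (show ((F (t + 1) : ℝ) : UnitAddCircle) = F t by rw [← hf, ← hf, AddCircle.coe_add_period])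
    exact ⟨n, by rw [hn]; ring⟩
  obtain ⟨k, hk⟩ := h 0
  refine ⟨k, fun t => ?_⟩
  rw [← hk, ← eq_of_continuous_of_forall_int (by fun_prop) h t 0]
  ring

theorem IsLift.exists_int_of_eq_add (hf : IsLift f F) {s t : ℝ} {n : ℤ} (h : F s = F t + n) :
    ∃ m : ℤ, s = t + m := by
  refine coe_eq_coe_iff.1 (f.injective ?_)
  rw [hf, hf]
  exact coe_eq_coe_iff.2 ⟨n, h⟩

theorem IsLift.isDegOne_or_strictAnti (hf : IsLift f F) : IsDegOne F ∨ StrictAnti F := by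
  refine (F.continuous.strictMono_of_inj F.injective).imp_left fun hm => ⟨hm, ?_⟩
  obtain ⟨k, hk⟩ := hf.exists_add_one
  have hk0 : 0 < (k : ℝ) := by
    have := hm (show (0 : ℝ) < 0 + 1 by norm_num)
    rw [hk] at this
    linarith
  have hk0' : 0 < k := by exact_mod_cast hk0
  obtain rfl | hk1 := (show 1 ≤ k from hk0').eq_or_lt
  · simpa using hk
  -- If `k > 1`, the value `F 0 + 1` is attained strictly between `0` and `1`, yet injectivity of
  -- `f` makes that point an integer.
  obtain ⟨s, hs⟩ := F.surjective (F 0 + (1 : ℤ))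
  obtain ⟨m, rfl⟩ := hf.exists_int_of_eq_add hs
  have hk1' : (1 : ℝ) < k := by exact_mod_cast hk1
  have h0 : (0 : ℝ) < 0 + m := hm.lt_iff_lt.1 (by rw [hs]; simp)
  have h1 : (0 : ℝ) + m < 0 + 1 := hm.lt_iff_lt.1 (by rw [hs, hk]; simpa using hk1')
  rw [zero_add] at h0 h1
  rw [zero_add] at h1
  have h0' : 0 < m := by exact_mod_cast h0
  have h1' : m < 1 := by exact_mod_cast h1
  omega

theorem exists_fixedPoint_of_strictAnti (hF : StrictAnti F) : ∃ t, F t = t := by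
  obtain h | h := le_total (F 0) 0
  · obtain ⟨t, ht⟩ := mem_range_of_exists_le_of_exists_ge (f := fun t => t - F t) (c := 0)
      (by fun_prop) ⟨F 0, by have := hF.antitone h; linarith⟩ ⟨0, by simpa using h⟩
    exact ⟨t, by simp only at ht; linarith⟩
  · obtain ⟨t, ht⟩ := mem_range_of_exists_le_of_exists_ge (f := fun t => t - F t) (c := 0)
      (by fun_prop) ⟨0, by simpa using h⟩ ⟨F 0, by have := hF.antitone h; linarith⟩
    exact ⟨t, by simp only at ht; linarith⟩

theorem IsDegOne.add_int (hF : IsDegOne F) (t : ℝ) (n : ℤ) : F (t + n) = F t + n := by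
  have : ∀ (n : ℕ) (t : ℝ), F (t + n) = F t + n := fun n => by
    induction n with
    | zero => simp
    | succ n ih => intro t; rw [Nat.cast_succ, ← add_assoc, hF.map_add_one, ih, add_assoc]
  obtain ⟨n, rfl | rfl⟩ := n.eq_nat_or_neg
  · simpa using this n t
  · have := this n (t + (-(n : ℤ) : ℤ))
    push_cast at this ⊢
    rw [neg_add_cancel_right] at this
    linarith

/-- An orientation preserving lift as an element of `CircleDeg1Lift`. -/
def IsDegOne.toLift (hF : IsDegOne F) : CircleDeg1Lift :=
  ⟨⟨F, hF.strictMono.monotone⟩, hF.map_add_one⟩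

theorem IsDegOne.coe_toLift (hF : IsDegOne F) : ⇑hF.toLift = F := rfl

theorem coe_pow_eq_iterate {X : Type*} [TopologicalSpace X] (f : X ≃ₜ X) (n : ℕ) :
    ⇑(f ^ n) = f^[n] := by
  induction n with
  | zero => rfl
  | succ n ih => rw [pow_succ, Function.iterate_succ, ← ih]; rfl

theorem IsDegOne.tendsto (hF : IsDegOne F) (t : ℝ) :
    Tendsto (fun n : ℕ => (F^[n] t - t) / n) atTop (𝓝 hF.toLift.translationNumber) := by
  simpa only [CircleDeg1Lift.coe_pow, hF.coe_toLift] using hF.toLift.tendsto_translationNumber t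

/-- `f` has an iterate `f ^ m`, `m ≥ 1`, with an increasing lift that has a fixed point. -/
def HasFixedLift (f : UnitAddCircle ≃ₜ UnitAddCircle) (m : ℕ) (G : ℝ ≃ₜ ℝ) : Prop :=
  0 < m ∧ IsLift (f ^ m) G ∧ StrictMono G ∧ ∃ t, G t = t

theorem IsLift.hasFixedLift_of_strictAnti (hf : IsLift f F) (hF : StrictAnti F) :
    HasFixedLift f 2 (F ^ 2) := by
  obtain ⟨t, ht⟩ := exists_fixedPoint_of_strictAnti hF
  refine ⟨two_pos, hf.pow 2, fun x y h => ?_, t, ?_⟩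
  · rw [pow_two]; exact hF (hF h)
  · rw [pow_two, Homeomorph.mul_apply, ht, ht]

/-- For translation number `p/q`, some point is moved by exactly `p` under `F ^ q`; then `F ^ q - p`
lifts `f ^ q` and fixes it. -/
theorem IsLift.hasFixedLift_of_rat (hf : IsLift f F) (hF : IsDegOne F) {r : ℚ}
    (hr : hF.toLift.translationNumber = r) : ∃ m G, HasFixedLift f m G := by
  have hr' : hF.toLift.translationNumber = (r.num : ℝ) / (r.den : ℝ) := by
    rw [hr, ← Rat.cast_def]
  obtain ⟨x, hx⟩ := (hF.toLift.translationNumber_eq_rat_iff F.continuous r.den_pos).1 hr'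
  rw [CircleDeg1Lift.coe_pow, hF.coe_toLift, ← coe_pow_eq_iterate] at hx
  refine ⟨r.den, (F ^ r.den).trans (Homeomorph.addRight (-(r.num : ℝ))), r.den_pos, fun t => ?_,
    fun s t h => ?_, x, ?_⟩
  · rw [hf.pow r.den t]
    exact coe_eq_coe_iff.2 ⟨r.num, by simp⟩
  · have : (F ^ r.den) s < (F ^ r.den) t := by
      rw [coe_pow_eq_iterate]; exact hF.strictMono.iterate _ h
    simpa using this
  · simp [hx]

theorem HasRationalRotationNumber.exists_hasFixedLift (hf : HasRationalRotationNumber f) :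
    ∃ m G, HasFixedLift f m G := by
  obtain ⟨r, F, hF, h⟩ := hf
  obtain h1 | h1 := hF.isDegOne_or_strictAnti
  · exact hF.hasFixedLift_of_rat h1 (tendsto_nhds_unique (h1.tendsto 0) (h 0))
  · exact ⟨_, _, hF.hasFixedLift_of_strictAnti h1⟩

theorem HasIrrationalRotationNumber.exists_isDegOne (hf : HasIrrationalRotationNumber f) :
    ∃ (F : ℝ ≃ₜ ℝ) (hF : IsDegOne F), IsLift f F ∧ Irrational hF.toLift.translationNumber := by
  obtain ⟨ρ, hρ, F, hF, h⟩ := hf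
  obtain h1 | h1 := hF.isDegOne_or_strictAnti
  · exact ⟨F, h1, hF, by rwa [tendsto_nhds_unique (h1.tendsto 0) (h 0)]⟩
  · obtain ⟨t, ht⟩ := exists_fixedPoint_of_strictAnti h1
    have h2 := h t
    simp only [Function.iterate_fixed ht, sub_self, zero_div] at h2
    exact absurd (tendsto_nhds_unique h2 tendsto_const_nhds) hρ.ne_zero

theorem exists_hasFixedLift_or_isDegOne (f : UnitAddCircle ≃ₜ UnitAddCircle) :
    (∃ m G, HasFixedLift f m G) ∨
    ∃ (F : ℝ ≃ₜ ℝ) (hF : IsDegOne F), IsLift f F ∧ Irrational hF.toLift.translationNumber := by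
  obtain ⟨F, hF⟩ := exists_isLift f
  obtain h1 | h1 := hF.isDegOne_or_strictAnti
  · by_cases h : Irrational h1.toLift.translationNumber
    · exact Or.inr ⟨F, h1, hF, h⟩
    · obtain ⟨r, hr⟩ := not_not.1 h
      exact Or.inl (hF.hasFixedLift_of_rat h1 hr.symm)
  · exact Or.inl ⟨_, _, hF.hasFixedLift_of_strictAnti h1⟩

end Lift

end InnerDistal

namespace InnerDistal

/-! ### Monotone iteration: trapped orbits and convergence to fixed points -/

section Iterate

variable {α : Type*} [LinearOrder α] {v : α → ℝ} {φ : α → α} {t y : α}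

/-- Both orbits are trapped between `φ^[n] t` and `φ^[n + 2] t`, whose `v`-values converge to a
common limit. Trapping `φ y` rather than `y` makes the admissible `y` near `t` a preimage of an open
interval. The map `v` lets one proof serve `ℝ` and `I`. -/
theorem tendsto_abs_iterate_sub_of_le (hv : Monotone v) (hφ : Monotone φ)
    (hb : ∃ C, ∀ n, v (φ^[n] t) ≤ C) (ht : t ≤ φ t) (h1 : t ≤ φ y) (h2 : φ y ≤ φ (φ t)) :
    Tendsto (fun n => |v (φ^[n + 1] y) - v (φ^[n + 1] t)|) atTop (𝓝 0) := by
  have hm : Monotone fun n => v (φ^[n] t) := hv.comp (hφ.monotone_iterate_of_le_map ht)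
  obtain ⟨C, hC⟩ := hb
  refine tendsto_abs_sub_of_abs_sub_le (a := fun n => v (φ^[n] t))
    (tendsto_atTop_ciSup hm ⟨C, by rintro _ ⟨n, rfl⟩; exact hC n⟩) fun n => ?_
  have e1 : v (φ^[n] t) ≤ v (φ^[n + 1] y) := hv (hφ.iterate n h1)
  have e2 : v (φ^[n + 1] y) ≤ v (φ^[n + 2] t) := hv (hφ.iterate n h2)
  have e3 := hm (Nat.le_succ n)
  have e4 := hm (Nat.le_succ (n + 1))
  simp only [Nat.succ_eq_add_one, add_assoc, one_add_one_eq_two] at e3 e4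
  rw [abs_of_nonneg (a := v (φ^[n + 2] t) - v (φ^[n] t)) (by linarith)]
  exact abs_le.2 ⟨by linarith, by linarith⟩

theorem tendsto_abs_iterate_sub_of_ge (hv : Monotone v) (hφ : Monotone φ)
    (hb : ∃ C, ∀ n, C ≤ v (φ^[n] t)) (ht : φ t ≤ t) (h1 : φ y ≤ t) (h2 : φ (φ t) ≤ φ y) :
    Tendsto (fun n => |v (φ^[n + 1] y) - v (φ^[n + 1] t)|) atTop (𝓝 0) := by
  obtain ⟨C, hC⟩ := hb
  have := tendsto_abs_iterate_sub_of_le (α := αᵒᵈ) (v := fun x : αᵒᵈ => -v (OrderDual.ofDual x))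
    (φ := φ) (t := t) (y := y) (fun a b h => neg_le_neg (hv h)) hφ.dual
    ⟨-C, fun n => neg_le_neg (hC n)⟩ ht h1 h2
  have e : ∀ a b : ℝ, |-a - -b| = |a - b| := fun a b => by rw [← abs_neg]; congr 1; ring
  exact this.congr fun n => e _ _

end Iterate

theorem tendsto_iterate_fixedPoint_of_gt {φ : ℝ → ℝ} (hc : Continuous φ) (hφ : Monotone φ)
    {p y : ℝ} (hp : φ p = p) (hpy : p ≤ y) (hy : φ y ≤ y) (h : ∀ z, p < z → z ≤ y → φ z ≠ z) :
    Tendsto (fun n => φ^[n] y) atTop (𝓝 p) := by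
  have hm : Antitone fun n => φ^[n] y := hφ.antitone_iterate_of_map_le hy
  have hpl : ∀ n, p ≤ φ^[n] y := fun n => by
    have := hφ.iterate n hpy
    rwa [Function.iterate_fixed hp] at this
  have hl := tendsto_atTop_ciInf hm ⟨p, by rintro _ ⟨n, rfl⟩; exact hpl n⟩
  have hfix := isFixedPt_of_tendsto_iterate hl hc.continuousAt
  have h1 := ge_of_tendsto' hl hpl
  have h2 := le_of_tendsto' hl fun n => hm (Nat.zero_le n)
  obtain h3 | h3 := h1.eq_or_lt
  · rwa [← h3] at hl
  · exact absurd hfix (h _ h3 h2)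

theorem tendsto_iterate_fixedPoint_of_lt {φ : ℝ → ℝ} (hc : Continuous φ) (hφ : Monotone φ)
    {p y : ℝ} (hp : φ p = p) (hpy : y ≤ p) (hy : y ≤ φ y) (h : ∀ z, z < p → y ≤ z → φ z ≠ z) :
    Tendsto (fun n => φ^[n] y) atTop (𝓝 p) := by
  have hm : Monotone fun n => φ^[n] y := hφ.monotone_iterate_of_le_map hy
  have hpl : ∀ n, φ^[n] y ≤ p := fun n => by
    have := hφ.iterate n hpy
    rwa [Function.iterate_fixed hp] at this
  have hl := tendsto_atTop_ciSup hm ⟨p, by rintro _ ⟨n, rfl⟩; exact hpl n⟩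
  have hfix := isFixedPt_of_tendsto_iterate hl hc.continuousAt
  have h1 := le_of_tendsto' hl hpl
  have h2 := ge_of_tendsto' hl fun n => hm (Nat.zero_le n)
  obtain h3 | h3 := h1.eq_or_lt
  · rwa [h3] at hl
  · exact absurd hfix (h _ h3 h2)

theorem IsInnerDistalMeasure.notMem_support {X : Type*} [MetricSpace X] [MeasurableSpace X]
    {f : X ≃ₜ X} {μ : Measure X} (hμ : IsInnerDistalMeasure f μ) {x : X}
    (h : proximalCell f x ∈ 𝓝 x) : x ∉ μ.support :=
  Measure.notMem_support_iff_exists.2 ⟨_, interior_mem_nhds.2 h, hμ x⟩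

theorem IsInnerDistal.proximalCell_notMem_nhds {X : Type*} [MetricSpace X]
    {f : X ≃ₜ X} (hf : IsInnerDistal f) (x : X) : proximalCell f x ∉ 𝓝 x := fun h => by
  have := mem_interior_iff_mem_nhds.2 h
  rw [hf x] at this
  exact this

/-! ### Circle homeomorphisms with an iterate having a fixed lift -/

section Circle

variable {f : UnitAddCircle ≃ₜ UnitAddCircle} {m : ℕ} {F G : ℝ ≃ₜ ℝ}

theorem coe_image_mem_nhds {t : ℝ} {U : Set ℝ} (hU : U ∈ 𝓝 t) :
    ((↑) : ℝ → UnitAddCircle) '' U ∈ 𝓝 (t : UnitAddCircle) :=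
  QuotientAddGroup.isOpenMap_coe.image_mem_nhds hU

theorem IsLift.mem_proximalCell (hf : IsLift f F) {s t : ℝ} (k : ℕ → ℤ)
    (h : Tendsto (fun n => |(F ^ k n) s - (F ^ k n) t|) atTop (𝓝 0)) :
    (t : UnitAddCircle) ∈ proximalCell f s := by
  refine mem_proximalCell_of_tendsto k (squeeze_zero (fun n => dist_nonneg) (fun n => ?_) h)
  rw [hf.zpow, hf.zpow]
  exact dist_coe_le _ _

theorem IsLift.mem_proximalCell_of_iterate (hf : IsLift f F) {s t : ℝ}
    (h : Tendsto (fun n => |F^[n] s - F^[n] t|) atTop (𝓝 0)) :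
    (t : UnitAddCircle) ∈ proximalCell f s :=
  hf.mem_proximalCell (fun n => n) (by simpa only [zpow_natCast, coe_pow_eq_iterate] using h)

theorem IsLift.mem_proximalCell_of_iterate_symm (hf : IsLift f F) {s t : ℝ}
    (h : Tendsto (fun n => |F.symm^[n] s - F.symm^[n] t|) atTop (𝓝 0)) :
    (t : UnitAddCircle) ∈ proximalCell f s := by
  refine hf.mem_proximalCell (fun n => -n) ?_
  have : ∀ n : ℕ, ⇑(F ^ (-n : ℤ)) = F.symm^[n] := fun n => by
    rw [zpow_neg, zpow_natCast, ← inv_pow, coe_pow_eq_iterate]; rfl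
  simpa only [this] using h

theorem HasFixedLift.isDegOne (h : HasFixedLift f m G) : IsDegOne G :=
  (h.2.1.isDegOne_or_strictAnti).resolve_right fun ha =>
    lt_asymm (h.2.2.1 zero_lt_one) (ha zero_lt_one)

theorem HasFixedLift.mem_nhds_of_ne (h : HasFixedLift f m G) {t : ℝ} (ht : G t ≠ t) :
    proximalCell f t ∈ 𝓝 (t : UnitAddCircle) := by
  have hd := h.isDegOne
  obtain ⟨hm, hl, hG, p, hp⟩ := h
  have hp' : ∀ n : ℤ, ∀ k : ℕ, G^[k] (p + n) = p + n := fun n k =>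
    Function.iterate_fixed (by rw [hd.add_int, hp]) k
  have key : ∀ U ∈ 𝓝 t,
      (∀ y ∈ U, Tendsto (fun n => |id (G^[n + 1] y) - id (G^[n + 1] t)|) atTop (𝓝 0)) →
      proximalCell f t ∈ 𝓝 (t : UnitAddCircle) := fun U hU hy => by
    refine mem_of_superset (coe_image_mem_nhds hU) ?_
    rintro _ ⟨y, hyU, rfl⟩
    refine proximalCell_pow_subset f m _ (hl.mem_proximalCell_of_iterate ?_)
    refine (tendsto_add_atTop_iff_nat 1).1 ((hy y hyU).congr fun n => abs_sub_comm _ _)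
  obtain hlt | hlt := ht.lt_or_gt
  · refine key (G ⁻¹' Set.Ioo (G (G t)) t)
      ((isOpen_Ioo.preimage G.continuous).mem_nhds ⟨hG hlt, hlt⟩) fun y hy => ?_
    -- The integer translate of `p` just below `t` is fixed by `G`, hence bounds the decreasing
    -- orbit.
    refine tendsto_abs_iterate_sub_of_ge monotone_id hG.monotone ⟨p + ⌊t - p⌋, fun n => ?_⟩
      hlt.le hy.2.le hy.1.le
    rw [← hp' _ n]
    exact hG.monotone.iterate n (by linarith [Int.floor_le (t - p)])
  · refine key (G ⁻¹' Set.Ioo t (G (G t)))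
      ((isOpen_Ioo.preimage G.continuous).mem_nhds ⟨hlt, hG hlt⟩) fun y hy => ?_
    refine tendsto_abs_iterate_sub_of_le monotone_id hG.monotone ⟨p + ⌈t - p⌉, fun n => ?_⟩
      hlt.le hy.1.le hy.2.le
    rw [← hp' _ n]
    exact hG.monotone.iterate n (by linarith [Int.le_ceil (t - p)])

theorem HasFixedLift.mem_periodicPts (h : HasFixedLift f m G) {t : ℝ} (ht : G t = t) :
    (t : UnitAddCircle) ∈ Function.periodicPts f :=
  ⟨m, h.1, by
    rw [Function.IsPeriodicPt, Function.IsFixedPt, ← coe_pow_eq_iterate, h.2.1, ht]⟩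

theorem HasFixedLift.support_subset (h : HasFixedLift f m G) {μ : Measure UnitAddCircle}
    (hμ : IsInnerDistalMeasure f μ) : μ.support ⊆ Function.periodicPts f := by
  intro x hx
  obtain ⟨t, rfl⟩ := QuotientAddGroup.mk_surjective x
  by_contra hper
  exact hμ.notMem_support (h.mem_nhds_of_ne fun ht => hper (h.mem_periodicPts ht)) hx

/-- A fixed point `t` of `G` is now isolated among fixed points, so each nearby `y` tends to `t`
under `G` or under its inverse. -/
theorem HasFixedLift.mem_nhds_of_finite (h : HasFixedLift f m G)
    (hfin : (Function.periodicPts f).Finite) (t : ℝ) :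
    proximalCell f t ∈ 𝓝 (t : UnitAddCircle) := by
  by_cases ht : G t ≠ t
  · exact h.mem_nhds_of_ne ht
  rw [not_not] at ht
  have hV : (Function.periodicPts f \ {(t : UnitAddCircle)})ᶜ ∈ 𝓝 (t : UnitAddCircle) :=
    (hfin.subset Set.sdiff_subset).isClosed.isOpen_compl.mem_nhds (by simp)
  obtain ⟨ε, hε, hU⟩ := Metric.mem_nhds_iff.1
    ((AddCircle.continuous_mk' (1 : ℝ)).continuousAt.preimage_mem_nhds hV)
  -- The bound `1` excludes integer translates of `t`, which project to the same periodic point.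
  have hne : ∀ z, z ≠ t → |z - t| < min ε 1 → G z ≠ z := fun z hz hzt hfix => by
    refine hU (Metric.mem_ball.2 (hzt.trans_le (min_le_left _ _))) ⟨h.mem_periodicPts hfix, ?_⟩
    intro he
    obtain ⟨n, rfl⟩ := coe_eq_coe_iff.1 he
    rw [add_sub_cancel_left] at hzt
    have h1 : |(n : ℝ)| < 1 := hzt.trans_le (min_le_right _ _)
    have h2 : |n| < 1 := by exact_mod_cast h1
    rw [Int.abs_lt_one_iff.1 h2] at hz
    simp at hz
  have hts : G.symm t = t := by rw [Homeomorph.symm_apply_eq, ht]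
  have hGs : StrictMono G.symm := fun a b hab => by
    rw [← h.2.2.1.lt_iff_lt, G.apply_symm_apply, G.apply_symm_apply]; exact hab
  have hnes : ∀ z, z ≠ t → |z - t| < min ε 1 → G.symm z ≠ z := fun z hz hzt hfix =>
    hne z hz hzt (by rw [Homeomorph.symm_apply_eq] at hfix; exact hfix.symm)
  refine mem_of_superset (coe_image_mem_nhds (Metric.ball_mem_nhds t
    (lt_min hε zero_lt_one))) ?_
  rintro _ ⟨y, hy, rfl⟩
  rw [Metric.mem_ball, Real.dist_eq] at hy
  refine proximalCell_pow_subset f m _ ?_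
  have key : ∀ {φ : ℝ → ℝ}, φ t = t → Tendsto (fun n => φ^[n] y) atTop (𝓝 t) →
      Tendsto (fun n => |φ^[n] t - φ^[n] y|) atTop (𝓝 0) := fun hφ hlim => by
    simpa [Function.iterate_fixed hφ] using (tendsto_const_nhds.sub hlim :
      Tendsto _ _ (𝓝 (t - t))).abs
  have hlt1 : ∀ z, z < t → y ≤ z → |z - t| < min ε 1 := fun z h1 h2 =>
    lt_of_le_of_lt (by rw [abs_of_nonpos (by linarith), abs_of_nonpos (by linarith)]; linarith) hy
  have hlt2 : ∀ z, t < z → z ≤ y → |z - t| < min ε 1 := fun z h1 h2 =>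
    lt_of_le_of_lt (by rw [abs_of_nonneg (by linarith), abs_of_nonneg (by linarith)]; linarith) hy
  -- The inverse is iterated in the two cases where `G` pushes `y` away from `t`.
  obtain hyt | hyt := le_total y t <;> obtain hG | hG := le_total (G y) y
  · refine h.2.1.mem_proximalCell_of_iterate_symm (key hts
      (tendsto_iterate_fixedPoint_of_lt G.symm.continuous hGs.monotone hts hyt ?_
        fun z h1 h2 => hnes z h1.ne (hlt1 z h1 h2)))
    simpa using hGs.monotone hG
  · exact h.2.1.mem_proximalCell_of_iterate (key ht
      (tendsto_iterate_fixedPoint_of_lt G.continuous h.2.2.1.monotone ht hyt hG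
        fun z h1 h2 => hne z h1.ne (hlt1 z h1 h2)))
  · exact h.2.1.mem_proximalCell_of_iterate (key ht
      (tendsto_iterate_fixedPoint_of_gt G.continuous h.2.2.1.monotone ht hyt hG
        fun z h1 h2 => hne z h1.ne' (hlt2 z h1 h2)))
  · refine h.2.1.mem_proximalCell_of_iterate_symm (key hts
      (tendsto_iterate_fixedPoint_of_gt G.symm.continuous hGs.monotone hts hyt ?_
        fun z h1 h2 => hnes z h1.ne' (hlt2 z h1 h2)))
    simpa using hGs.monotone hG

theorem HasFixedLift.measure_eq_zero_of_finite (h : HasFixedLift f m G)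
    (hfin : (Function.periodicPts f).Finite) {μ : Measure UnitAddCircle}
    (hμ : IsInnerDistalMeasure f μ) : μ = 0 := by
  rw [← Measure.measure_univ_eq_zero]
  refine measure_null_of_locally_null _ fun x _ => ?_
  obtain ⟨t, rfl⟩ := QuotientAddGroup.mk_surjective x
  exact ⟨_, mem_nhdsWithin_of_mem_nhds (interior_mem_nhds.2 (h.mem_nhds_of_finite hfin t)), hμ _⟩

theorem HasFixedLift.isDistal (h : HasFixedLift f m G) (hf : IsInnerDistal f) : IsDistal f := by
  refine .of_pow_eq_one h.1 (Homeomorph.ext fun x => ?_)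
  obtain ⟨t, rfl⟩ := QuotientAddGroup.mk_surjective x
  by_contra hne
  refine hf.proximalCell_notMem_nhds _ (h.mem_nhds_of_ne (t := t) fun ht => hne ?_)
  exact (h.2.1 t).trans (by rw [ht]; rfl)

end Circle

/-! ### Homeomorphisms of the interval -/

section Interval

theorem proximalCell_mem_nhds_of_strictMono {f : I ≃ₜ I} (hf : StrictMono f) {x : I}
    (hx : f x ≠ x) : proximalCell f x ∈ 𝓝 x := by
  have hv : Monotone fun x : I => (x : ℝ) := fun a b h => h
  have key : ∀ U ∈ 𝓝 x,
      (∀ y ∈ U, Tendsto (fun n => |((f^[n + 1] y : I) : ℝ) - (f^[n + 1] x : I)|) atTop (𝓝 0)) →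
      proximalCell f x ∈ 𝓝 x := fun U hU hy => by
    refine mem_of_superset hU fun y hyU => ?_
    refine mem_proximalCell_of_tendsto (fun n => ((n + 1 : ℕ) : ℤ)) ((hy y hyU).congr fun n => ?_)
    rw [zpow_natCast, coe_pow_eq_iterate, dist_comm, Subtype.dist_eq, Real.dist_eq]
  obtain hlt | hlt := hx.lt_or_gt
  · refine key (f ⁻¹' Set.Ioo (f (f x)) x)
      ((isOpen_Ioo.preimage f.continuous).mem_nhds ⟨hf hlt, hlt⟩) fun y hy => ?_
    exact tendsto_abs_iterate_sub_of_ge hv hf.monotone ⟨0, fun n => (f^[n] x).2.1⟩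
      hlt.le hy.2.le hy.1.le
  · refine key (f ⁻¹' Set.Ioo x (f (f x)))
      ((isOpen_Ioo.preimage f.continuous).mem_nhds ⟨hlt, hf hlt⟩) fun y hy => ?_
    exact tendsto_abs_iterate_sub_of_le hv hf.monotone ⟨1, fun n => (f^[n] x).2.2⟩
      hlt.le hy.1.le hy.2.le

theorem pow_eq_one_of_isInnerDistal {f : I ≃ₜ I} (hf : IsInnerDistal f) {m : ℕ}
    (h : StrictMono (f ^ m)) : f ^ m = 1 := by
  ext x : 1
  by_contra hne
  refine hf.proximalCell_notMem_nhds x (mem_of_superset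
    (proximalCell_mem_nhds_of_strictMono h hne) (proximalCell_pow_subset f m x))

theorem isConjugate_symm_of_strictAnti {f : I ≃ₜ I} (hf : StrictAnti f) (h : ∀ x, f (f x) = x) :
    IsConjugate f unitInterval.symmHomeomorph := by
  have hc := f.continuous
  -- Averaging `x` with `1 - f x` symmetrises: since `f` is an involution, replacing `x` by `f x`
  -- turns the average into its reflection.
  let φ : I → I := fun x => ⟨((x : ℝ) + (1 - f x)) / 2, by
    constructor <;> linarith [x.2.1, x.2.2, (f x).2.1, (f x).2.2]⟩
  have hφc : Continuous φ := by fun_prop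
  have hφm : StrictMono φ := fun x y hxy => by
    have h1 : (x : ℝ) < y := hxy
    have h2 : ((f y : I) : ℝ) < f x := hf hxy
    exact Subtype.coe_lt_coe.1 (by simp only [φ]; linarith)
  have hf0 : f 0 = 1 := by
    refine le_antisymm (f 0).2.2 ?_
    have := hf.antitone (show 0 ≤ f 1 from (f 1).2.1)
    rwa [h] at this
  have hf1 : f 1 = 0 := by rw [← hf0, h]
  have hφs : Function.Surjective φ := by
    have h0 : φ 0 = 0 := Subtype.ext (by simp [φ, hf0])
    have h1 : φ 1 = 1 := Subtype.ext (by simp [φ, hf1])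
    intro z
    exact mem_range_of_exists_le_of_exists_ge hφc ⟨0, by rw [h0]; exact z.2.1⟩
      ⟨1, by rw [h1]; exact z.2.2⟩
  refine ⟨hφc.homeoOfEquivCompactToT2 (f := Equiv.ofBijective φ ⟨hφm.injective, hφs⟩), fun x => ?_⟩
  refine Subtype.ext ?_
  change ((f x : ℝ) + (1 - f (f x))) / 2 = 1 - ((x : ℝ) + (1 - f x)) / 2
  rw [h]
  ring

theorem isInnerDistal_interval_iff {f : I ≃ₜ I} :
    IsInnerDistal f ↔ f = Homeomorph.refl I ∨ IsConjugate f unitInterval.symmHomeomorph := by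
  constructor
  · intro hf
    obtain h | h := f.continuous.strictMono_of_inj f.injective
    · left
      exact (pow_one f).symm.trans (pow_eq_one_of_isInnerDistal hf (by rwa [pow_one]))
    · right
      have h2 : f ^ 2 = 1 := pow_eq_one_of_isInnerDistal hf fun x y hxy => by
        rw [pow_two]; exact h (h hxy)
      refine isConjugate_symm_of_strictAnti h fun x => ?_
      rw [pow_two] at h2
      exact DFunLike.congr_fun h2 x
  · rintro (rfl | ⟨h, hh⟩)
    · exact (IsDistal.of_pow_eq_one one_pos (pow_one _)).isInnerDistal
    · refine (IsDistal.of_pow_eq_one two_pos (Homeomorph.ext fun x => h.injective ?_)).isInnerDistal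
      rw [pow_two, Homeomorph.mul_apply, hh, hh]
      simp

theorem isOpenPosMeasure_volume_interval : (volume : Measure I).IsOpenPosMeasure := by
  refine ⟨fun U hU ⟨x, hx⟩ => ?_⟩
  obtain ⟨V, hV, rfl⟩ := isOpen_induced_iff.1 hU
  have hx' : (x : ℝ) ∈ closure (Set.Ioo (0 : ℝ) 1) := by
    rw [closure_Ioo zero_ne_one]; exact x.2
  have hne : (V ∩ Set.Ioo (0 : ℝ) 1).Nonempty := mem_closure_iff.1 hx' V hV hx
  have hpos := (hV.inter isOpen_Ioo).measure_pos volume hne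
  rw [unitInterval.volume_apply]
  refine (hpos.trans_le (measure_mono ?_)).ne'
  exact fun y hy => ⟨⟨y, hy.2.1.le, hy.2.2.le⟩, hy.1, rfl⟩

end Interval

end InnerDistal

/-! ### Irrational rotation number: semiconjugacy to a rotation -/

namespace InnerDistal

/-- `h` is a continuous monotone degree one semiconjugacy from a lift `F` of `f` to the
translation by the irrational number `ρ`. -/
structure IsRotationSemiconj (f : UnitAddCircle ≃ₜ UnitAddCircle) (F : ℝ ≃ₜ ℝ) (ρ : ℝ)
    (h : ℝ → ℝ) : Prop where
  isLift : IsLift f F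
  isDegOne : IsDegOne F
  irrational : Irrational ρ
  monotone : Monotone h
  continuous : Continuous h
  map_add_int : ∀ (t : ℝ) (n : ℤ), h (t + n) = h t + n
  semiconj : ∀ t, h (F t) = h t + ρ

variable {f : UnitAddCircle ≃ₜ UnitAddCircle} {F : ℝ ≃ₜ ℝ} {ρ : ℝ} {h : ℝ → ℝ}

theorem exists_add_mul_mem_Ioo (hρ : Irrational ρ) (c : ℝ) {a b : ℝ} (hab : a < b) :
    ∃ n m : ℤ, c + n * ρ + m ∈ Set.Ioo a b := by
  have hd : Dense (AddSubgroup.closure {ρ, 1} : Set ℝ) :=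
    dense_addSubgroupClosure_pair_iff.2 (by simpa using hρ)
  obtain ⟨z, hz, hz1, hz2⟩ := hd.exists_between (sub_lt_sub_right hab c)
  obtain ⟨n, m, rfl⟩ := AddSubgroup.mem_closure_pair.1 hz
  simp only [zsmul_eq_mul, mul_one] at hz1 hz2
  exact ⟨n, m, by linarith, by linarith⟩

theorem int_mul_add_int_inj (hρ : Irrational ρ) {n n' m m' : ℤ}
    (e : n * ρ + m = n' * ρ + m') : n = n' ∧ m = m' := by
  have h1 : n = n' := by
    by_contra hne
    have h2 : ((n - n' : ℤ) : ℝ) * ρ = (m' - m : ℤ) := by push_cast; linarith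
    exact (hρ.intCast_mul (sub_ne_zero.2 hne)).ne_int _ h2
  subst h1
  exact ⟨rfl, by exact_mod_cast add_left_cancel e⟩

theorem zpow_of_semiconj (hh : ∀ t, h (F t) = h t + ρ) (n : ℤ) (t : ℝ) :
    h ((F ^ n) t) = h t + n * ρ := by
  have h1 : ∀ (n : ℕ) t, h ((F ^ n) t) = h t + n * ρ := fun n => by
    induction n with
    | zero => simp
    | succ n ih => intro t; rw [pow_succ, Homeomorph.mul_apply, ih, hh]; push_cast; ring
  obtain ⟨k, rfl | rfl⟩ := n.eq_nat_or_neg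
  · simpa using h1 k t
  · have h2 := h1 k ((F ^ (-k : ℤ)) t)
    rw [← zpow_natCast, ← Homeomorph.mul_apply, ← zpow_add, add_neg_cancel, zpow_zero,
      Homeomorph.one_apply] at h2
    push_cast
    linarith

/-- Equal translation numbers give a monotone semiconjugacy. Its range contains a translate of the
dense group `ℤρ + ℤ`, and a monotone map with dense range is continuous. -/
theorem IsLift.exists_isRotationSemiconj (hl : IsLift f F) (hF : IsDegOne F)
    (hρ : Irrational hF.toLift.translationNumber) :
    ∃ ρ h, IsRotationSemiconj f F ρ h := by
  set ρ := hF.toLift.translationNumber with hρd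
  obtain ⟨h, hh⟩ := CircleDeg1Lift.semiconj_of_bijective_of_translationNumber_eq
    (f₁ := hF.toLift) (f₂ := CircleDeg1Lift.translate (Multiplicative.ofAdd ρ)) F.bijective
    (CircleDeg1Lift.isUnit_iff_bijective.1 (Units.isUnit _))
    (CircleDeg1Lift.translationNumber_translate ρ).symm
  have hh' : ∀ t, h (F t) = h t + ρ := fun t => by
    rw [add_comm]; simpa [hF.coe_toLift] using hh t
  have hadd : ∀ (t : ℝ) (n : ℤ), h (t + n) = h t + n := fun t n => h.map_add_int t n
  refine ⟨ρ, h, hl, hF, hρ, h.monotone, h.monotone.continuous_of_denseRange ?_, hadd, hh'⟩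
  refine dense_iff_exists_between.2 fun a b hab => ?_
  obtain ⟨n, m, hnm⟩ := exists_add_mul_mem_Ioo hρ (h 0) hab
  exact ⟨_, ⟨(F ^ n) 0 + m, rfl⟩, by rwa [hadd, zpow_of_semiconj hh']⟩

namespace IsRotationSemiconj

theorem map_zpow (H : IsRotationSemiconj f F ρ h) (n : ℤ) (t : ℝ) :
    h ((F ^ n) t) = h t + n * ρ := zpow_of_semiconj H.semiconj n t

theorem exists_uniform (H : IsRotationSemiconj f F ρ h) {ε : ℝ} (hε : 0 < ε) :
    ∃ δ > 0, ∀ x y, |x - y| ≤ δ → |h x - h y| < ε := by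
  have hu := (isCompact_Icc (a := (-1 : ℝ)) (b := 2)).uniformContinuousOn_of_continuous
    H.continuous.continuousOn
  obtain ⟨δ, hδ, hd⟩ := Metric.uniformContinuousOn_iff.1 hu ε hε
  refine ⟨min (δ / 2) 1, lt_min (half_pos hδ) one_pos, fun x y hxy => ?_⟩
  have h1 : |x - y| < δ := (hxy.trans (min_le_left _ _)).trans_lt (half_lt_self hδ)
  have h2 := abs_le.1 (hxy.trans (min_le_right _ _))
  have h3 := Int.floor_le x
  have h4 := (Int.lt_floor_add_one x).le
  have := hd (x + (-⌊x⌋ : ℤ)) ⟨by push_cast; linarith, by push_cast; linarith⟩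
    (y + (-⌊x⌋ : ℤ)) ⟨by push_cast; linarith, by push_cast; linarith⟩
    (by rwa [dist_add_right, Real.dist_eq])
  rwa [H.map_add_int, H.map_add_int, dist_add_right, Real.dist_eq] at this

/-- Otherwise all arcs `F ^ n [s, t]` have length at least `ε`. On them `h` is constant, with values
distinct modulo `1`, so they are disjoint on the circle and their left endpoints are `ε`-separated,
against compactness. -/
theorem mem_proximalCell_of_le (H : IsRotationSemiconj f F ρ h) {s t : ℝ} (hst : s ≤ t)
    (e : h s = h t) : (t : UnitAddCircle) ∈ proximalCell f s := by
  refine mem_proximalCell_iff.2 fun ε hε => ?_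
  by_contra! hcon
  have hlen : ∀ n : ℕ, (F ^ n) s + ε ≤ (F ^ n) t := fun n => by
    have h1 := hcon n
    rw [H.isLift.zpow, H.isLift.zpow, zpow_natCast] at h1
    have h2 := h1.trans (dist_coe_le _ _)
    have h3 : (F ^ n) s ≤ (F ^ n) t := by
      rw [coe_pow_eq_iterate]; exact H.isDegOne.strictMono.monotone.iterate n hst
    rw [abs_of_nonpos (by linarith)] at h2
    linarith
  have key : ∀ (n n' : ℕ) (k : ℤ), (F ^ n) s ≤ (F ^ n') s + k →
      (F ^ n') s + k < (F ^ n) s + ε → n = n' := fun n n' k h1 h2 => by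
    have h3 := H.monotone h1
    have h4 := H.monotone (h2.le.trans (hlen n))
    have h5 := fun n t => H.map_zpow (n : ℕ) t
    simp only [zpow_natCast] at h5
    rw [H.map_add_int, h5, h5] at h3 h4
    have h6 : ((n : ℤ) : ℝ) * ρ + (0 : ℤ) = (n' : ℤ) * ρ + k := by push_cast at *; linarith
    exact_mod_cast (int_mul_add_int_inj H.irrational h6).1
  obtain ⟨a, φ, hφ, hlim⟩ :=
    CompactSpace.tendsto_subseq fun n : ℕ => (((F ^ n) s : ℝ) : UnitAddCircle)
  obtain ⟨N, hN⟩ := Metric.cauchySeq_iff'.1 hlim.cauchySeq ε hε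
  have hd := hN (N + 1) (Nat.le_succ N)
  obtain ⟨k, hk⟩ := exists_dist_eq ((F ^ φ (N + 1)) s) ((F ^ φ N) s)
  simp only [Function.comp] at hd
  rw [hk, abs_lt] at hd
  have hne := (hφ (Nat.lt_succ_self N)).ne
  obtain h1 | h1 := le_total ((F ^ φ (N + 1)) s) ((F ^ φ N) s + k)
  · exact hne (key _ _ k h1 (by linarith)).symm
  · exact hne (key _ _ (-k) (by push_cast; linarith) (by push_cast; linarith))

theorem mem_proximalCell (H : IsRotationSemiconj f F ρ h) {s t : ℝ}
    (e : h s = h t) : (t : UnitAddCircle) ∈ proximalCell f s := by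
  obtain hst | hst := le_total s t
  · exact H.mem_proximalCell_of_le hst e
  · have := mem_proximalCell_iff.1 (H.mem_proximalCell_of_le hst e.symm)
    exact mem_proximalCell_iff.2 (by simpa only [dist_comm] using this)

theorem isDistal_iff (H : IsRotationSemiconj f F ρ h) :
    IsDistal f ↔ Function.Injective h := by
  constructor
  · intro hd s t e
    obtain ⟨k, rfl⟩ := coe_eq_coe_iff.1 (hd s t (H.mem_proximalCell e))
    rw [H.map_add_int] at e
    simpa using e
  · intro hi x y hxy
    obtain ⟨s, rfl⟩ := QuotientAddGroup.mk_surjective x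
    obtain ⟨t, rfl⟩ := QuotientAddGroup.mk_surjective y
    -- The difference of the `h`-values is invariant under `F`, so by uniform continuity it vanishes
    -- modulo `1` for proximal points.
    have h0 : (h s : UnitAddCircle) = h t := by
      refine dist_le_zero.1 (le_of_forall_pos_lt_add fun ε hε => ?_)
      obtain ⟨δ, hδ, hu⟩ := H.exists_uniform hε
      obtain ⟨n, hn⟩ := mem_proximalCell_iff.1 hxy δ hδ
      have hn' : dist (((F ^ n) s : ℝ) : UnitAddCircle) (((F ^ n) t : ℝ) : UnitAddCircle) < δ := by
        rw [← H.isLift.zpow, ← H.isLift.zpow]; exact hn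
      obtain ⟨k, hk⟩ := exists_dist_eq ((F ^ n) s) ((F ^ n) t)
      have h1 := hu _ _ (hk ▸ hn').le
      rw [H.map_add_int, H.map_zpow, H.map_zpow] at h1
      rw [zero_add, ← (coe_eq_coe_iff.2 ⟨k, rfl⟩ : ((h t + k : ℝ) : UnitAddCircle) = h t)]
      refine (dist_coe_le _ _).trans_lt ?_
      rwa [show h s - (h t + k) = h s + n * ρ - (h t + n * ρ + k) by ring]
    obtain ⟨k, hk⟩ := coe_eq_coe_iff.1 h0
    rw [← H.map_add_int] at hk
    exact coe_eq_coe_iff.2 ⟨k, hi hk⟩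

theorem isTransitive_iff (H : IsRotationSemiconj f F ρ h) :
    IsTransitive f ↔ Function.Injective h := by
  constructor
  · rintro ⟨x, hx⟩
    obtain ⟨c, rfl⟩ := QuotientAddGroup.mk_surjective x
    have key : ∀ a b : ℝ, a < b → ∃ n m : ℤ, (F ^ n) c + m ∈ Set.Ioo a b := fun a b hab => by
      obtain ⟨z, hz⟩ := Set.nonempty_Ioo.2 hab
      have hd : Dense (Set.range fun n : ℤ => (f ^ n) (c : UnitAddCircle)) :=
        dense_iff_closure_eq.2 hx
      obtain ⟨_, ⟨n, rfl⟩, y, hy, hy'⟩ :=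
        hd.inter_nhds_nonempty (coe_image_mem_nhds (Ioo_mem_nhds hz.1 hz.2))
      obtain ⟨m, rfl⟩ := coe_eq_coe_iff.1 (hy'.trans (H.isLift.zpow n c))
      exact ⟨n, m, hy⟩
    refine Function.Injective.of_lt_imp_ne fun s t hst e => ?_
    have hconst : ∀ z, s ≤ z → z ≤ t → h z = h s := fun z h1 h2 =>
      le_antisymm ((H.monotone h2).trans e.ge) (H.monotone h1)
    -- A dense orbit visits both halves of a plateau; equal `h`-values and irrationality force the
    -- two visits to be the same point.
    obtain ⟨n, m, h1, h2⟩ := key s ((s + t) / 2) (by linarith)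
    obtain ⟨n', m', h3, h4⟩ := key ((s + t) / 2) t (by linarith)
    have e1 := hconst _ h1.le (by linarith)
    have e2 := hconst _ (by linarith) h4.le
    rw [H.map_add_int, H.map_zpow] at e1 e2
    obtain ⟨rfl, rfl⟩ := int_mul_add_int_inj H.irrational
      (show (n : ℝ) * ρ + m = n' * ρ + m' by linarith)
    linarith
  · intro hi
    refine ⟨((0 : ℝ) : UnitAddCircle), Set.eq_univ_of_forall fun x => ?_⟩
    obtain ⟨t, rfl⟩ := QuotientAddGroup.mk_surjective x
    have hs := H.monotone.strictMono_of_injective hi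
    refine Metric.mem_closure_iff.2 fun ε hε => ?_
    obtain ⟨n, m, hnm⟩ := exists_add_mul_mem_Ioo H.irrational (h 0)
      (hs (show t - ε < t + ε by linarith))
    rw [← H.map_zpow, ← H.map_add_int] at hnm
    refine ⟨_, ⟨n, rfl⟩, ?_⟩
    simp only
    rw [H.isLift.zpow, ← (coe_eq_coe_iff.2 ⟨m, rfl⟩ :
      (((F ^ n) 0 + m : ℝ) : UnitAddCircle) = ((F ^ n) 0 : ℝ))]
    refine (dist_coe_le _ _).trans_lt (abs_lt.2 ⟨?_, ?_⟩)
    · linarith [hs.lt_iff_lt.1 hnm.2]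
    · linarith [hs.lt_iff_lt.1 hnm.1]

theorem isDistal_iff_isTransitive (H : IsRotationSemiconj f F ρ h) :
    IsDistal f ↔ IsTransitive f := H.isDistal_iff.trans H.isTransitive_iff.symm

theorem isDistal_of_isInnerDistal (H : IsRotationSemiconj f F ρ h) (hf : IsInnerDistal f) :
    IsDistal f := by
  refine H.isDistal_iff.2 (Function.Injective.of_lt_imp_ne fun s t hst e => ?_)
  have hconst : ∀ z ∈ Set.Ioo s t, h z = h s := fun z hz =>
    le_antisymm ((H.monotone hz.2.le).trans e.ge) (H.monotone hz.1.le)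
  have hc : (s + t) / 2 ∈ Set.Ioo s t := ⟨by linarith, by linarith⟩
  refine hf.proximalCell_notMem_nhds (((s + t) / 2 : ℝ) : UnitAddCircle)
    (mem_of_superset (coe_image_mem_nhds (Ioo_mem_nhds hc.1 hc.2)) ?_)
  rintro _ ⟨y, hy, rfl⟩
  exact H.mem_proximalCell ((hconst _ hc).trans (hconst _ hy).symm)

/-- If `h s ≠ h t`, some iterate places the two points on opposite sides of a plateau `[a, b]`,
hence more than `(b - a) / 2` apart. So points staying close forever share a fibre of `h`. -/
theorem exists_dynamicBall_subset (H : IsRotationSemiconj f F ρ h)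
    (hni : ¬ Function.Injective h) :
    ∃ δ > 0, ∀ x, dynamicBall f δ x ⊆ proximalCell f x := by
  obtain ⟨a, b, hab, e⟩ : ∃ a b, a < b ∧ h a = h b := by
    by_contra! hcon
    exact hni (Function.Injective.of_lt_imp_ne hcon)
  -- Two errors below `1 / 4` keep the integer `k` in `key` below `1` in absolute value, so
  -- closeness on the circle is closeness of the chosen lifts.
  obtain ⟨δ, hδ, hu⟩ := H.exists_uniform (show (0 : ℝ) < 1 / 4 by norm_num)
  have key : ∀ s t : ℝ, h s < h t → h t < h s + 1 / 4 →
      ∃ n : ℤ, min δ ((b - a) / 2) < dist (((F ^ n) s : ℝ) : UnitAddCircle) ((F ^ n) t : ℝ) := by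
    intro s t h1 h2
    obtain ⟨n, m, h3, h4⟩ := exists_add_mul_mem_Ioo H.irrational 0
      (show h a - h t < h a - h s by linarith)
    refine ⟨n, ?_⟩
    by_contra! hle
    obtain ⟨k, hk⟩ := exists_dist_eq ((F ^ n) s) ((F ^ n) t)
    rw [hk] at hle
    have h5 := hu _ _ (hle.trans (min_le_left _ _))
    rw [H.map_add_int, H.map_zpow, H.map_zpow, abs_lt] at h5
    have h6 : (-1 : ℝ) < k := by linarith
    have h7 : (k : ℝ) < 1 := by linarith
    have h6' : -1 < k := by exact_mod_cast h6
    have h7' : k < 1 := by exact_mod_cast h7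
    obtain rfl : k = 0 := by omega
    have h8 : (F ^ n) s + m < a := H.monotone.reflect_lt (by
      rw [H.map_add_int, H.map_zpow]; linarith)
    have h9 : b < (F ^ n) t + m := H.monotone.reflect_lt (by
      rw [H.map_add_int, H.map_zpow]; linarith)
    have h10 := (abs_le.1 (hle.trans (min_le_right _ _))).1
    push_cast at h10
    linarith
  refine ⟨min δ ((b - a) / 2), lt_min hδ (by linarith), fun x y hy => ?_⟩
  obtain ⟨s, rfl⟩ := QuotientAddGroup.mk_surjective x
  obtain ⟨t', rfl⟩ := QuotientAddGroup.mk_surjective y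
  have hy' : ∀ n : ℤ, dist (((F ^ n) s : ℝ) : UnitAddCircle) (((F ^ n) t' : ℝ)) ≤
      min δ ((b - a) / 2) := fun n => by
    rw [← H.isLift.zpow, ← H.isLift.zpow]; exact hy n
  obtain ⟨k, hk⟩ := exists_dist_eq s t'
  have ht : (((t' + k : ℝ)) : UnitAddCircle) = t' := coe_eq_coe_iff.2 ⟨k, rfl⟩
  set t := t' + k with htd
  have hy'' : ∀ n : ℤ, dist (((F ^ n) s : ℝ) : UnitAddCircle) (((F ^ n) t : ℝ)) ≤
      min δ ((b - a) / 2) := fun n => by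
    have := hy' n
    rwa [← H.isLift.zpow n t', ← ht, H.isLift.zpow n t] at this
  have h1 := hu s t (hk ▸ (hy' 0).trans (min_le_left _ _))
  rw [abs_lt] at h1
  change (t' : UnitAddCircle) ∈ proximalCell f (s : UnitAddCircle)
  rw [← ht]
  obtain hlt | heq | hlt := lt_trichotomy (h s) (h t)
  · obtain ⟨n, hn⟩ := key s t hlt (by linarith)
    exact absurd (hy'' n) hn.not_ge
  · exact H.mem_proximalCell heq
  · obtain ⟨n, hn⟩ := key t s hlt (by linarith)
    rw [dist_comm] at hn
    exact absurd (hy'' n) hn.not_ge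

end IsRotationSemiconj

theorem HasIrrationalRotationNumber.exists_isRotationSemiconj
    (hf : HasIrrationalRotationNumber f) : ∃ F ρ h, IsRotationSemiconj f F ρ h := by
  obtain ⟨F, hF, hl, hρ⟩ := hf.exists_isDegOne
  exact ⟨F, hl.exists_isRotationSemiconj hF hρ⟩

theorem HasIrrationalRotationNumber.exists_isConjugate_isDenjoy_iff
    (hf : HasIrrationalRotationNumber f) :
    (∃ g, IsDenjoy g ∧ IsConjugate f g) ↔ ¬ IsTransitive f :=
  ⟨fun ⟨_, hg, hfg⟩ ht => hg.2 (hfg.isTransitive ht), fun ht => ⟨f, ⟨hf, ht⟩, .refl f⟩⟩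

theorem isInnerDistal_circle_iff : IsInnerDistal f ↔ IsDistal f := by
  refine ⟨fun hf => ?_, fun hf => ?_⟩
  · obtain ⟨m, G, h⟩ | ⟨F, hF, hl, hρ⟩ := exists_hasFixedLift_or_isDegOne f
    · exact h.isDistal hf
    · obtain ⟨ρ, h, H⟩ := hl.exists_isRotationSemiconj hF hρ
      exact H.isDistal_of_isInnerDistal hf
  -- Nontriviality ensures that the circle has no isolated points, as `IsDistal.isInnerDistal`
  -- requires.
  · have : Nontrivial UnitAddCircle := by
      refine ⟨(0 : ℝ), (1 / 2 : ℝ), fun e => ?_⟩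
      obtain ⟨n, hn⟩ := coe_eq_coe_iff.1 e
      have h1 : (((2 * n + 1 : ℤ)) : ℝ) = (0 : ℤ) := by push_cast; linarith
      have h2 := Int.cast_injective h1
      omega
    exact hf.isInnerDistal

end InnerDistal

/-! ### Assembly of the four statements -/

theorem mainTheorem3 :
    -- (1) circle homeomorphisms with rational rotation number
    (∀ f : UnitAddCircle ≃ₜ UnitAddCircle, InnerDistal.HasRationalRotationNumber f →
      (∀ μ : Measure UnitAddCircle, IsProbabilityMeasure μ →
        InnerDistal.IsInnerDistalMeasure f μ → μ.support ⊆ Function.periodicPts f) ∧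
      ((Function.periodicPts f).Finite →
        ∀ μ : Measure UnitAddCircle, IsProbabilityMeasure μ →
          InnerDistal.IsInnerDistalMeasure f μ → InnerDistal.IsMeagreExpansiveMeasure f μ)) ∧
    -- (2) circle homeomorphisms with irrational rotation number
    (∀ f : UnitAddCircle ≃ₜ UnitAddCircle, InnerDistal.HasIrrationalRotationNumber f →
      Xor (InnerDistal.IsDistal f)
        (∃ g : UnitAddCircle ≃ₜ UnitAddCircle,
          InnerDistal.IsDenjoy g ∧ InnerDistal.IsConjugate f g) ∧
      ((∃ g : UnitAddCircle ≃ₜ UnitAddCircle,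
          InnerDistal.IsDenjoy g ∧ InnerDistal.IsConjugate f g) →
        ∀ μ : Measure UnitAddCircle, IsProbabilityMeasure μ →
          InnerDistal.IsInnerDistalMeasure f μ → InnerDistal.IsMeagreExpansiveMeasure f μ)) ∧
    -- (3) inner-distal measures with full support, and inner-distality, on the circle
    (∀ f : UnitAddCircle ≃ₜ UnitAddCircle,
      ((∃ μ : Measure UnitAddCircle, IsProbabilityMeasure μ ∧
          InnerDistal.IsInnerDistalMeasure f μ ∧ μ.support = Set.univ) ↔
        InnerDistal.IsDistal f) ∧
      (InnerDistal.IsInnerDistal f ↔ InnerDistal.IsDistal f)) ∧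
    -- (4) inner-distal measures with full support on the interval
    (∀ f : I ≃ₜ I,
      (∃ μ : Measure I, IsProbabilityMeasure μ ∧
          InnerDistal.IsInnerDistalMeasure f μ ∧ μ.support = Set.univ) ↔
        f = Homeomorph.refl I ∨ InnerDistal.IsConjugate f unitInterval.symmHomeomorph) := by

  refine ⟨fun f hf => ?_, fun f hf => ?_, fun f => ?_, fun f => ?_⟩
  · obtain ⟨m, G, h⟩ := hf.exists_hasFixedLift
    -- The choice `δ = 1` is arbitrary: finiteness of the periodic set forces `μ = 0`.
    refine ⟨fun μ _ hμ => h.support_subset hμ, fun hfin μ _ hμ => ⟨1, one_pos, fun x => ?_⟩⟩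
    rw [h.measure_eq_zero_of_finite hfin hμ, Measure.coe_zero, Pi.zero_apply]
  · obtain ⟨F, ρ, h, H⟩ := hf.exists_isRotationSemiconj
    rw [hf.exists_isConjugate_isDenjoy_iff, H.isDistal_iff_isTransitive]
    refine ⟨?_, fun ht μ _ hμ => ?_⟩
    · by_cases ht : InnerDistal.IsTransitive f
      · exact Or.inl ⟨ht, not_not.2 ht⟩
      · exact Or.inr ⟨ht, ht⟩
    · obtain ⟨δ, hδ, hsub⟩ := H.exists_dynamicBall_subset (mt H.isTransitive_iff.2 ht)
      exact ⟨δ, hδ, fun x => measure_mono_null (interior_mono (hsub x)) (hμ x)⟩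
  · refine ⟨?_, InnerDistal.isInnerDistal_circle_iff⟩
    rw [← InnerDistal.isInnerDistal_circle_iff]
    have : IsProbabilityMeasure (volume : Measure UnitAddCircle) := ⟨UnitAddCircle.measure_univ⟩
    exact InnerDistal.exists_isInnerDistalMeasure_iff volume
  · rw [← InnerDistal.isInnerDistal_interval_iff]
    have := InnerDistal.isOpenPosMeasure_volume_interval
    exact InnerDistal.exists_isInnerDistalMeasure_iff volume
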